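/- All categories have small hom-sets, and ``set'' means small set. A factorization system $(\mathcal E,\mathcal M)$ in a category $\mathcal K$ is a pair of classes of morphisms such that every morphism factors as an $\mathcal E$-morphism followed by an $\mathcal M$-morphism, $\mathcal M$ consists exactly of the morphisms having the unique right lifting property with respect to all of $\mathcal E$, and $\mathcal E$ exactly of those having the unique left lifting property with respect to all of $\mathcal M$. Let $\lambda$ be a regular cardinal. A $\lambda$-directed colimit of $\mathcal M$-morphisms is a colimit of a diagram indexed by a (small) $\lambda$-directed poset all of whose transition morphisms are in $\mathcal M$. The factorization system $(\mathcal E,\mathcal M)$ is $\lambda$-convenient if (i) every object $X$ of $\mathcal K$ has, up to isomorphism under $X$, only a set of $\mathcal E$-morphisms with domain $X$, and (ii) for every $\lambda$-directed colimit of $\mathcal M$-morphisms in $\mathcal K$, the colimit cocone consists of $\mathcal M$-morphisms, and for every cocone consisting of $\mathcal M$-morphisms the induced morphism from the colimit is in $\mathcal M$. It is convenient if it is $\lambda$-convenient for some regular $\lambda$. An object $A$ is $\lambda$-generated with respect to $\mathcal M$ if $\mathcal K(A,-):\mathcal K\to\mathbf{Set}$ preserves $\lambda$-directed colimits of $\mathcal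 M$-morphisms. $\mathcal K$ is $\mathcal M$-locally $\lambda$-generated if it is cocomplete, $(\mathcal E,\mathcal M)$ is $\lambda$-convenient, and there is a set $\mathcal A$ of objects $\lambda$-generated with respect to $\mathcal M$ such that every object of $\mathcal K$ is a $\lambda$-directed colimit of objects from $\mathcal A$ and morphisms from $\mathcal M$. It is $\mathcal M$-locally generated if it is $\mathcal M$-locally $\lambda$-generated for some regular $\lambda$. Theorem. For every category $\mathcal K$ the following are equivalent: (1) $\mathcal K$ is locally presentable; (2) $\mathcal K$ is $\mathcal M$-locally generated for some convenient factorization system $(\mathcal E,\mathcal M)$ in $\mathcal K$; (3) $\mathcal K$ is $\mathcal M$-locally generated for every convenient factorization system $(\mathcal E,\mathcal M)$ in $\mathcal K$. -/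

import Mathlib

open CategoryTheory Limits Opposite

universe w u

namespace LocGen

variable {C : Type u} [Category.{w} C]

/-- `e ⊥ m`: every commutative square from `e` to `m` has exactly one diagonal. -/
def Orthogonal {A B X Y : C} (e : A ⟶ B) (m : X ⟶ Y) : Prop :=
  ∀ (f : A ⟶ X) (g : B ⟶ Y), f ≫ m = e ≫ g → ∃! d : B ⟶ X, e ≫ d = f ∧ d ≫ m = g

/-- `(E, M)` is an (orthogonal) factorization system: every morphism is an `E`-morphism
followed by an `M`-morphism, and the classes `E` and `M` determine each other by
orthogonality. -/
structure IsFactorizationSystem (E M : MorphismProperty C) : Prop where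
  left_iff {A B : C} (e : A ⟶ B) :
    E e ↔ ∀ {X Y : C} (m : X ⟶ Y), M m → Orthogonal e m
  right_iff {X Y : C} (m : X ⟶ Y) :
    M m ↔ ∀ {A B : C} (e : A ⟶ B), E e → Orthogonal e m
  hasFactorization : E.HasFactorization M

/-- All the transition morphisms of the diagram `D` belong to `M`. -/
def IsDiagramOf (M : MorphismProperty C) {J : Type w} [Category.{w} J] (D : J ⥤ C) : Prop :=
  ∀ ⦃i j : J⦄ (f : i ⟶ j), M (D.map f)

/-- `C` is `E`-cowellpowered: for every object `X`, the `E`-morphisms with domain `X` form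
a set up to isomorphism under `X`. -/
def IsCowellpowered (E : MorphismProperty C) : Prop :=
  ∀ X : C, ObjectProperty.EssentiallySmall.{w} (fun f : Under X => E f.hom)

/-- `M` is closed under `κ`-directed colimits. A `κ`-directed poset is a poset
which is `κ`-filtered as a category. -/
structure IsClosedUnderDirectedColimits (M : MorphismProperty C)
    (κ : Cardinal.{w}) [Fact κ.IsRegular] : Prop where
  ι_mem (J : Type w) [PartialOrder J] [IsCardinalFiltered J κ] (D : J ⥤ C)
    (hD : IsDiagramOf M D) (c : Cocone D) (hc : IsColimit c) (j : J) : M (c.ι.app j)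
  desc_mem (J : Type w) [PartialOrder J] [IsCardinalFiltered J κ] (D : J ⥤ C)
    (hD : IsDiagramOf M D) (c : Cocone D) (hc : IsColimit c)
    (s : Cocone D) (hs : ∀ j, M (s.ι.app j)) : M (hc.desc s)

/-- `(E, M)` is a `κ`-convenient factorization system. -/
structure IsCardinalConvenient (E M : MorphismProperty C)
    (κ : Cardinal.{w}) [Fact κ.IsRegular] : Prop where
  isFactorizationSystem : IsFactorizationSystem E M
  isCowellpowered : IsCowellpowered E
  isClosed : IsClosedUnderDirectedColimits M κ

/-- `(E, M)` is a convenient factorization system. -/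
def IsConvenient (E M : MorphismProperty C) : Prop :=
  ∃ (κ : Cardinal.{w}) (_ : Fact κ.IsRegular), IsCardinalConvenient E M κ

/-- `A` is `κ`-generated with respect to `M`: the functor `C(A, -)` preserves
`κ`-directed colimits of `M`-morphisms. -/
def IsCardinalGenerated (M : MorphismProperty C) (κ : Cardinal.{w}) [Fact κ.IsRegular]
    (A : C) : Prop :=
  ∀ (J : Type w) [PartialOrder J] [IsCardinalFiltered J κ] (D : J ⥤ C),
    IsDiagramOf M D → PreservesColimit D (coyoneda.obj (op A))

/-- The category `C`, with the factorization system `(E, M)`, is `M`-locally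
`κ`-generated. -/
structure IsCardinalLocallyGenerated (E M : MorphismProperty C)
    (κ : Cardinal.{w}) [Fact κ.IsRegular] : Prop where
  hasColimits : HasColimitsOfSize.{w, w} C
  isCardinalConvenient : IsCardinalConvenient E M κ
  exists_generators : ∃ 𝒜 : ObjectProperty C, ObjectProperty.Small.{w} 𝒜 ∧
    (∀ A, 𝒜 A → IsCardinalGenerated M κ A) ∧
    ∀ X : C, ∃ (J : Type w) (_ : PartialOrder J) (_ : IsCardinalFiltered J κ)
      (p : ColimitPresentation J X), (∀ j, 𝒜 (p.diag.obj j)) ∧ IsDiagramOf M p.diag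

/-- The category `C`, with the factorization system `(E, M)`, is `M`-locally generated. -/
def IsLocallyGenerated (E M : MorphismProperty C) : Prop :=
  ∃ (κ : Cardinal.{w}) (_ : Fact κ.IsRegular), IsCardinalLocallyGenerated E M κ

end LocGen

namespace LocGen

variable {C : Type u} [Category.{w} C]

/-! (1) ⇒ (3): enlarge the cardinal until it serves both local presentability and convenience. Write
an object `X` as a directed colimit of presentable objects and replace each of them by its `(E,
M)`-image in `X`. The images form an `M`-diagram, still with colimit `X`
(`exists_colimitPresentation`); they are `E`-quotients of presentable objects, hence generated, and
form a set by cowellpoweredness.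

(3) ⇒ (2): apply (3) to the convenient system (isomorphisms, all morphisms).

(2) ⇒ (1): the `κ`-generated objects form an essentially small class, and every object is the
canonical colimit of those over it. Choose a regular `μ ≥ κ` exceeding the number of `E`-quotients
of any generated object. A `μ`-directed diagram `D`, with arbitrary transition morphisms, has the
same colimit as the diagram of generated objects over the `D.obj j`. The reduced ones among these
are cofinal (`exists_isReduced`) and form an `M`-diagram, which homs out of generated objects
respect. So generated objects are `μ`-presentable (`isCardinalPresentable`), and they strongly
generate. -/

lemma Orthogonal.of_isIso_left {A B X Y : C} (e : A ⟶ B) [IsIso e] (m : X ⟶ Y) :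
    Orthogonal e m := fun f g h =>
  ⟨inv e ≫ f, ⟨by simp, by simp [h]⟩, fun d hd => by simp [← hd.1]⟩

lemma Orthogonal.of_isIso_right {A B X Y : C} (e : A ⟶ B) (m : X ⟶ Y) [IsIso m] :
    Orthogonal e m := fun f g h =>
  ⟨g ≫ inv m, ⟨by simp [← reassoc_of% h], by simp⟩, fun d hd => by simp [← hd.2]⟩

lemma Orthogonal.hom_ext {A B X Y : C} {e : A ⟶ B} {m : X ⟶ Y} (h : Orthogonal e m)
    {d d' : B ⟶ X} (h₁ : e ≫ d = e ≫ d') (h₂ : d ≫ m = d' ≫ m) : d = d' :=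
  (h (e ≫ d') (d' ≫ m) (by simp)).unique ⟨h₁, h₂⟩ ⟨rfl, rfl⟩

/-! ### Closure properties of the two classes of a factorization system. -/

namespace IsFactorizationSystem

variable {E M : MorphismProperty C}

lemma orthogonal (h : IsFactorizationSystem E M)
    {A B X Y : C} {e : A ⟶ B} {m : X ⟶ Y} (he : E e) (hm : M m) :
    Orthogonal e m := (h.left_iff e).1 he m hm

lemma left_of_isIso (h : IsFactorizationSystem E M) {A B : C} (e : A ⟶ B) [IsIso e] : E e :=
  (h.left_iff e).2 fun m _ => .of_isIso_left e m

lemma right_of_isIso (h : IsFactorizationSystem E M) {A B : C} (m : A ⟶ B) [IsIso m] : M m :=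
  (h.right_iff m).2 fun e _ => .of_isIso_right e m

lemma left_comp (h : IsFactorizationSystem E M)
    {X Y Z : C} {f : X ⟶ Y} {g : Y ⟶ Z} (hf : E f) (hg : E g) : E (f ≫ g) :=
  (h.left_iff _).2 fun m hm a b hab => by
    obtain ⟨d, ⟨hd₁, hd₂⟩, -⟩ := h.orthogonal hf hm a (g ≫ b) (by simpa using hab)
    obtain ⟨d', ⟨hd₁', hd₂'⟩, -⟩ := h.orthogonal hg hm d b hd₂
    refine ⟨d', ⟨by simp [hd₁', hd₁], hd₂'⟩, fun t ht => ?_⟩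
    refine (h.orthogonal hg hm).hom_ext ((h.orthogonal hf hm).hom_ext ?_ ?_) (ht.2.trans hd₂'.symm)
    · rw [hd₁', hd₁, ← ht.1, Category.assoc]
    · rw [Category.assoc, Category.assoc, ht.2, hd₂']

lemma right_comp (h : IsFactorizationSystem E M)
    {X Y Z : C} {f : X ⟶ Y} {g : Y ⟶ Z} (hf : M f) (hg : M g) : M (f ≫ g) :=
  (h.right_iff _).2 fun e he a b hab => by
    obtain ⟨d, ⟨hd₁, hd₂⟩, -⟩ := h.orthogonal he hg (a ≫ f) b (by simpa using hab)
    obtain ⟨d', ⟨hd₁', hd₂'⟩, -⟩ := h.orthogonal he hf a d hd₁.symm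
    refine ⟨d', ⟨hd₁', by rw [reassoc_of% hd₂', hd₂]⟩, fun t ht => ?_⟩
    refine (h.orthogonal he hf).hom_ext (ht.1.trans hd₁'.symm) ((h.orthogonal he hg).hom_ext ?_ ?_)
    · rw [reassoc_of% ht.1, reassoc_of% hd₁']
    · rw [Category.assoc, Category.assoc, ht.2, reassoc_of% hd₂', hd₂]

lemma right_of_comp (h : IsFactorizationSystem E M)
    {X Y Z : C} {f : X ⟶ Y} {g : Y ⟶ Z} (hfg : M (f ≫ g)) (hg : M g) : M f :=
  (h.right_iff _).2 fun e he a b hab => by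
    obtain ⟨d, ⟨hd₁, hd₂⟩, -⟩ := h.orthogonal he hfg a (b ≫ g) (by simp [reassoc_of% hab])
    refine ⟨d, ⟨hd₁, (h.orthogonal he hg).hom_ext ?_ ?_⟩, fun t ht => ?_⟩
    · rw [reassoc_of% hd₁, hab]
    · simpa using hd₂
    · exact (h.orthogonal he hfg).hom_ext (ht.1.trans hd₁.symm) (by simp [hd₂, reassoc_of% ht.2])

lemma left_of_comp (h : IsFactorizationSystem E M)
    {X Y Z : C} {f : X ⟶ Y} {g : Y ⟶ Z} (hfg : E (f ≫ g)) (hf : E f) : E g :=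
  (h.left_iff _).2 fun m hm a b hab => by
    obtain ⟨d, ⟨hd₁, hd₂⟩, -⟩ := h.orthogonal hfg hm (f ≫ a) b (by simp [hab])
    refine ⟨d, ⟨(h.orthogonal hf hm).hom_ext ?_ ?_, hd₂⟩, fun t ht => ?_⟩
    · simpa using hd₁
    · rw [Category.assoc, hd₂, hab]
    · exact (h.orthogonal hfg hm).hom_ext (by simp [ht.1, hd₁]) (ht.2.trans hd₂.symm)

lemma isIso_of_left_of_right (h : IsFactorizationSystem E M)
    {X Y : C} {f : X ⟶ Y} (hf : E f) (hf' : M f) : IsIso f := by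
  obtain ⟨d, ⟨hd₁, hd₂⟩, -⟩ := h.orthogonal hf hf' (𝟙 X) (𝟙 Y) (by simp)
  exact ⟨d, hd₁, hd₂⟩

lemma exists_fac (h : IsFactorizationSystem E M) {X Y : C} (f : X ⟶ Y) :
    ∃ (Z : C) (e : X ⟶ Z) (m : Z ⟶ Y), E e ∧ M m ∧ e ≫ m = f := by
  obtain ⟨d⟩ := h.hasFactorization.nonempty_mapFactorizationData f
  exact ⟨d.Z, d.i, d.p, d.hi, d.hp, d.fac⟩

/-- A colimit of `E`-morphisms is an `E`-morphism. -/
lemma left_of_isColimit (h : IsFactorizationSystem E M)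
    {J : Type*} [Category* J] {F G : J ⥤ C} (α : F ⟶ G)
    (hα : ∀ j, E (α.app j)) {c : Cocone F} (hc : IsColimit c) {c' : Cocone G}
    (hc' : IsColimit c') (f : c.pt ⟶ c'.pt) (hf : ∀ j, c.ι.app j ≫ f = α.app j ≫ c'.ι.app j) :
    E f :=
  (h.left_iff f).2 fun {X Y} m hm a b hab => by
    choose d hd _ using fun j => h.orthogonal (hα j) hm (c.ι.app j ≫ a) (c'.ι.app j ≫ b)
      (by rw [Category.assoc, hab, reassoc_of% hf j])
    let s : Cocone G :=
      { pt := X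
        ι :=
          { app := d
            naturality i j φ := (h.orthogonal (hα i) hm).hom_ext
              (by
                dsimp
                rw [Category.comp_id, ← α.naturality_assoc, (hd j).1, (hd i).1, c.w_assoc])
              (by
                dsimp
                rw [Category.comp_id, Category.assoc, (hd j).2, (hd i).2, c'.w_assoc]) } }
    refine ⟨hc'.desc s, ⟨hc.hom_ext fun j => ?_, hc'.hom_ext fun j => ?_⟩,
      fun t ht => hc'.hom_ext fun j => ?_⟩
    · rw [reassoc_of% hf j, hc'.fac, (hd j).1]
    · rw [hc'.fac_assoc, (hd j).2]
    · refine (h.orthogonal (hα j) hm).hom_ext ?_ ?_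
      · rw [← reassoc_of% hf j, ht.1, hc'.fac, (hd j).1]
      · rw [Category.assoc, ht.2, hc'.fac, (hd j).2]

/-- In a cocomplete category, cowellpoweredness forces the left class to consist of
epimorphisms: otherwise the wide pushouts of copies of `e` would have too many maps to some
object. -/
lemma epi_of_left [HasColimitsOfSize.{w, w} C] (h : IsFactorizationSystem E M)
    (hE : IsCowellpowered E) {A B : C} (e : A ⟶ B) (he : E e) : Epi e where
  left_cancellation {Z} a b hab := by
    by_contra hne
    obtain ⟨Q, _, hQ, hQ'⟩ := (hE A).exists_small_le
    -- `I` counts all maps to `Z` from representatives of the `E`-quotients of `A`. The pushout `T`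
    -- of `I` copies of `e` is itself such a quotient, but will have at least `2 ^ I` maps to `Z`,
    -- against Cantor.
    let I : Type w := Shrink.{w} (Σ f : Subtype Q, (f.1.right ⟶ Z))
    let T : C := widePushout A (fun _ : I => B) (fun _ => e)
    let t : A ⟶ T := WidePushout.head _
    let i (x : I) : B ⟶ T := WidePushout.ι (fun _ : I => e) x
    have hi (x : I) : e ≫ i x = t := WidePushout.arrow_ι (fun _ : I => e) x
    have htE : E t := (h.left_iff t).2 fun {X Y} m hm p q hpq => by
      choose d hd _ using fun x : I => h.orthogonal he hm p (i x ≫ q)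
        (by rw [reassoc_of% hi x, hpq])
      refine ⟨WidePushout.desc p d (fun x => (hd x).1), ⟨?_, ?_⟩, fun r hr => ?_⟩
      · exact WidePushout.head_desc _ _ _ _
      · apply WidePushout.hom_ext
        · intro x
          exact (WidePushout.ι_desc_assoc _ _ _ _ _ _).trans (hd x).2
        · exact (WidePushout.head_desc_assoc _ _ _ _ _).trans hpq
      · apply WidePushout.hom_ext
        · intro x
          rw [WidePushout.ι_desc]
          refine (h.orthogonal he hm).hom_ext ?_ ?_
          · rw [(hd x).1, ← hr.1, ← hi x, Category.assoc]
          · rw [(hd x).2, Category.assoc, hr.2]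
        · rw [WidePushout.head_desc]
          exact hr.1
    obtain ⟨R, hR, ⟨φ⟩⟩ := hQ' (Under.mk t) htE
    let φ' : T ≅ R.right := (Under.forget A).mapIso φ
    let ψ (S : Set I) : T ⟶ Z :=
      haveI := Classical.decPred (· ∈ S)
      WidePushout.desc (e ≫ a) (fun x => if x ∈ S then a else b)
        (fun x => by split_ifs <;> simp [hab])
    have hψ (S : Set I) (x : I) : x ∈ S ↔ i x ≫ ψ S = a := by
      have : i x ≫ ψ S = haveI := Classical.decPred (· ∈ S); if x ∈ S then a else b :=
        WidePushout.ι_desc _ _ _ _ _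
      rw [this]
      split_ifs with hx
      · simp [hx]
      · simp [hx, Ne.symm hne]
    refine Function.cantor_injective
      (fun S : Set I => (equivShrink _ ⟨⟨R, hR⟩, φ'.inv ≫ ψ S⟩ : I)) fun S S' hSS' => ?_
    have h₁ := (equivShrink _).injective hSS'
    simp only [Sigma.mk.injEq, heq_eq_eq, true_and] at h₁
    have h₂ : ψ S = ψ S' := (cancel_epi φ'.inv).1 h₁
    ext x
    rw [hψ, hψ, h₂]

end IsFactorizationSystem

lemma preservesColimit_coyoneda {J : Type w} [Category.{w} J] [IsFiltered J] {D : J ⥤ C} {A : C}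
    (h₁ : ∀ (c : Cocone D), IsColimit c → ∀ f : A ⟶ c.pt,
      ∃ (j : J) (p : A ⟶ D.obj j), p ≫ c.ι.app j = f)
    (h₂ : ∀ (c : Cocone D), IsColimit c → ∀ (j : J) (p q : A ⟶ D.obj j),
      p ≫ c.ι.app j = q ≫ c.ι.app j → ∃ (k : J) (u : j ⟶ k), p ≫ D.map u = q ≫ D.map u) :
    PreservesColimit D (coyoneda.obj (op A)) where
  preserves {c} hc := ⟨Types.FilteredColimit.isColimitOf' _ _
    (fun f => by
      obtain ⟨j, p, hp⟩ := h₁ c hc f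
      exact ⟨j, p, hp.symm⟩)
    (fun j p q hpq => h₂ c hc j p q hpq)⟩

lemma IsClosedUnderDirectedColimits.of_le {M : MorphismProperty C} {κ κ' : Cardinal.{w}}
    [Fact κ.IsRegular] [Fact κ'.IsRegular] (h : IsClosedUnderDirectedColimits M κ)
    (hκ : κ ≤ κ') : IsClosedUnderDirectedColimits M κ' where
  ι_mem J _ _ D hD c hc j :=
    have := IsCardinalFiltered.of_le J hκ
    h.ι_mem J D hD c hc j
  desc_mem J _ _ D hD c hc s hs :=
    have := IsCardinalFiltered.of_le J hκ
    h.desc_mem J D hD c hc s hs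

lemma IsCardinalConvenient.of_le {E M : MorphismProperty C} {κ κ' : Cardinal.{w}}
    [Fact κ.IsRegular] [Fact κ'.IsRegular] (h : IsCardinalConvenient E M κ)
    (hκ : κ ≤ κ') : IsCardinalConvenient E M κ' :=
  ⟨h.isFactorizationSystem, h.isCowellpowered, h.isClosed.of_le hκ⟩

lemma isCardinalGenerated_of_isCardinalPresentable (M : MorphismProperty C) (κ : Cardinal.{w})
    [Fact κ.IsRegular] (A : C) [IsCardinalPresentable A κ] : IsCardinalGenerated M κ A :=
  fun J _ _ _ _ =>
    have := preservesColimitsOfShape_of_isCardinalPresentable A κ J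
    inferInstance

/-! ### Objects generated with respect to `M`. -/

section

variable {E M : MorphismProperty C} {κ : Cardinal.{w}} [Fact κ.IsRegular]

namespace IsCardinalGenerated

/-- Objects generated with respect to `M` are also compatible with colimits of `M`-morphisms
indexed by arbitrary `κ`-filtered categories. -/
lemma preservesColimit {A : C} (hA : IsCardinalGenerated M κ A) {J : Type w} [Category.{w} J]
    [IsCardinalFiltered J κ] {D : J ⥤ C} (hD : IsDiagramOf M D) :
    PreservesColimit D (coyoneda.obj (op A)) where
  preserves {c} hc := by
    obtain ⟨α, _, _, F, _⟩ := IsCardinalFiltered.exists_cardinal_directed J κ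
    have := hA α (F ⋙ D) (fun _ _ f => hD (F.map f))
    exact ⟨(Functor.Final.isColimitWhiskerEquiv F _)
      (isColimitOfPreserves (coyoneda.obj (op A))
        ((Functor.Final.isColimitWhiskerEquiv F c).symm hc))⟩

/-- Colimit coprojections lie in `M`, so a factorization of `e ≫ f` through a stage extends along
`e` by the diagonal; uniqueness of diagonals handles equalities. -/
lemma of_left (h : IsCardinalConvenient E M κ) {A B : C} (hA : IsCardinalGenerated M κ A)
    {e : A ⟶ B} (he : E e) : IsCardinalGenerated M κ B := fun J _ _ D hD => by
  have := hA J D hD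
  have := isFiltered_of_isCardinalFiltered J κ
  have hO (c : Cocone D) (hc : IsColimit c) (j : J) : Orthogonal e (c.ι.app j) :=
    h.isFactorizationSystem.orthogonal he (h.isClosed.ι_mem J D hD c hc j)
  refine preservesColimit_coyoneda (fun c hc f => ?_) (fun c hc j p q hpq => ?_)
  · obtain ⟨j, p, hp⟩ := exists_hom_of_preservesColimit_coyoneda hc (e ≫ f)
    obtain ⟨d, ⟨-, hd⟩, -⟩ := hO c hc j p f hp
    exact ⟨j, d, hd⟩
  · obtain ⟨k, u, hu⟩ := exists_eq_of_preservesColimit_coyoneda_self hc (e ≫ p) (e ≫ q)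
      (by simp [hpq])
    exact ⟨k, u, (hO c hc k).hom_ext (by simpa using hu) (by simpa using hpq)⟩

/-- Homs out of `c.pt` are a `κ`-small limit of homs out of the `Y.obj k`, and such limits commute
with `κ`-filtered colimits of sets. -/
lemma of_isColimit {K : Type w} [Category.{w} K] (hK : HasCardinalLT (Arrow K) κ) {Y : K ⥤ C}
    (hY : ∀ k, IsCardinalGenerated M κ (Y.obj k)) {c : Cocone Y} (hc : IsColimit c) :
    IsCardinalGenerated M κ c.pt := fun J _ _ D hD => ⟨fun {cD} hcD => by
  have (k : K) := hY k J D hD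
  exact ⟨Functor.Accessible.Limits.isColimitMapCocone (F := Y.op ⋙ coyoneda)
    (coyoneda.mapCone c.op)
    (fun Z => isLimitOfPreserves ((evaluation C (Type w)).obj Z)
      (isLimitOfPreserves coyoneda hc.op)) κ (by simpa) cD
    (fun k => isColimitOfPreserves (coyoneda.obj (op (Y.obj k.unop))) hcD)⟩⟩

end IsCardinalGenerated

/-- The objects which are `κ`-generated with respect to `M` form a set up to isomorphism. -/
lemma IsCardinalLocallyGenerated.essentiallySmall (h : IsCardinalLocallyGenerated E M κ) :
    ObjectProperty.EssentiallySmall.{w} (IsCardinalGenerated (C := C) M κ) := by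
  obtain ⟨𝒜, _, h₁, h₂⟩ := h.exists_generators
  refine .of_le (Q := 𝒜.retractClosure) fun A hA => ?_
  obtain ⟨J, _, _, p, hp, hp'⟩ := h₂ A
  have := hA J p.diag hp'
  -- Factoring the identity through a stage exhibits `A` as a retract of an object of `𝒜`.
  obtain ⟨j, f, hf⟩ := exists_hom_of_preservesColimit_coyoneda p.isColimit (𝟙 A)
  exact ⟨_, hp j, ⟨{ i := _, r := _, retract := hf }⟩⟩

end

lemma isCardinalFiltered_of_fullyFaithful {J J' : Type*} [Category* J] [Category* J']
    (F : J ⥤ J') [F.Full] [F.Faithful] (h : ∀ j' : J', ∃ j : J, Nonempty (j' ⟶ F.obj j))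
    (κ : Cardinal.{w}) [Fact κ.IsRegular] [IsCardinalFiltered J' κ] :
    IsCardinalFiltered J κ where
  nonempty_cocone K hK := by
    let c := IsCardinalFiltered.cocone (K ⋙ F) hK
    obtain ⟨j, ⟨f⟩⟩ := h c.pt
    exact ⟨{ pt := j
             ι := { app a := F.preimage (c.ι.app a ≫ f)
                    naturality a b g := F.map_injective (by
                      have := c.w g
                      dsimp at this
                      simp [reassoc_of% this]) } }⟩

/-- The fully faithful functor `G` identifies the small category `S` with the full subcategory of
the objects which are `κ`-generated with respect to `M`. -/
structure IsGeneratedModel (M : MorphismProperty C) (κ : Cardinal.{w}) [Fact κ.IsRegular]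
    {S : Type w} [Category.{w} S] (G : S ⥤ C) : Prop where
  full : G.Full
  faithful : G.Faithful
  isCardinalGenerated (s : S) : IsCardinalGenerated M κ (G.obj s)
  exists_iso (A : C) (hA : IsCardinalGenerated M κ A) : ∃ s : S, Nonempty (G.obj s ≅ A)

section

variable {E M : MorphismProperty C} {κ : Cardinal.{w}} [Fact κ.IsRegular]

lemma IsCardinalLocallyGenerated.exists_isGeneratedModel
    (h : IsCardinalLocallyGenerated E M κ) :
    ∃ (S : Type w) (_ : Category.{w} S) (G : S ⥤ C), IsGeneratedModel M κ G := by
  have := h.essentiallySmall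
  let P : ObjectProperty C := IsCardinalGenerated M κ
  let e := equivSmallModel.{w} P.FullSubcategory
  exact ⟨SmallModel.{w} P.FullSubcategory, inferInstance, e.inverse ⋙ P.ι, inferInstance,
    inferInstance, fun s => (e.inverse.obj s).property, fun A hA =>
      ⟨e.functor.obj ⟨A, hA⟩, ⟨P.ι.mapIso (e.unitIso.symm.app ⟨A, hA⟩)⟩⟩⟩

namespace IsGeneratedModel

variable {S : Type w} [Category.{w} S] {G : S ⥤ C}

/-- Morphisms from `X` are determined by their composites with generated objects over `X`. -/
lemma hom_ext (hG : IsGeneratedModel M κ G) (h : IsCardinalLocallyGenerated E M κ)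
    {X Z : C} {d d' : X ⟶ Z} (hd : ∀ (s : S) (f : G.obj s ⟶ X), f ≫ d = f ≫ d') : d = d' := by
  obtain ⟨𝒜, _, h₁, h₂⟩ := h.exists_generators
  obtain ⟨J, _, _, p, hp, hp'⟩ := h₂ X
  refine p.isColimit.hom_ext fun j => ?_
  obtain ⟨s, ⟨i⟩⟩ := hG.exists_iso _ (h₁ _ (hp j))
  rw [← cancel_epi i.hom]
  simpa using hd s (i.hom ≫ p.ι.app j)

/-- Every object is the canonical colimit of the generated objects over it. -/
lemma exists_desc (hG : IsGeneratedModel M κ G) (h : IsCardinalLocallyGenerated E M κ)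
    {X Z : C} (φ : ∀ s : S, (G.obj s ⟶ X) → (G.obj s ⟶ Z))
    (hφ : ∀ (s t : S) (u : s ⟶ t) (f : G.obj t ⟶ X), φ s (G.map u ≫ f) = G.map u ≫ φ t f) :
    ∃ d : X ⟶ Z, ∀ (s : S) (f : G.obj s ⟶ X), f ≫ d = φ s f := by
  have := hG.full
  obtain ⟨𝒜, _, h₁, h₂⟩ := h.exists_generators
  obtain ⟨J, _, _, p, hp, hp'⟩ := h₂ X
  choose s hs using fun j => hG.exists_iso _ (h₁ _ (hp j))
  let i (j : J) : G.obj (s j) ≅ p.diag.obj j := (hs j).some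
  -- Naturality of `φ` makes the value on a composite through stage `j` depend only on the leg at
  -- `j`; this gives both the cocone and its compatibility with `φ`.
  have key (t : S) (j : J) (g : G.obj t ⟶ p.diag.obj j) :
      g ≫ (i j).inv ≫ φ _ ((i j).hom ≫ p.ι.app j) = φ t (g ≫ p.ι.app j) := by
    rw [← Category.assoc, ← G.map_preimage (g ≫ (i j).inv), ← hφ, G.map_preimage]
    simp
  let c : Cocone p.diag :=
    { pt := Z
      ι :=
        { app j := (i j).inv ≫ φ _ ((i j).hom ≫ p.ι.app j)
          naturality j k f := by
            have := key (s j) k ((i j).hom ≫ p.diag.map f)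
            rw [Category.assoc, Category.assoc, p.w] at this
            rw [← cancel_epi (i j).hom, this]
            simp } }
  refine ⟨p.isColimit.desc c, fun t f => ?_⟩
  have := hG.isCardinalGenerated t J p.diag hp'
  obtain ⟨j, g, rfl⟩ := exists_hom_of_preservesColimit_coyoneda p.isColimit f
  rw [Category.assoc, p.isColimit.fac]
  exact key t j g

/-! ### Generated objects over a diagram, and presentability. -/

variable {J : Type w} [Category.{w} J] {D : J ⥤ C}

variable (G) in
/-- A cocone over `D` induces a cocone over the generated objects equipped with a morphism to some
object of `D`. -/
@[simps]
def commaCocone (c : Cocone D) : Cocone (Comma.fst G D ⋙ G) where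
  pt := c.pt
  ι :=
    { app x := x.hom ≫ c.ι.app x.right
      naturality x y f := by
        have hw : G.map f.left ≫ y.hom = x.hom ≫ D.map f.right := f.w
        change G.map f.left ≫ y.hom ≫ c.ι.app y.right = (x.hom ≫ c.ι.app x.right) ≫ 𝟙 _
        rw [reassoc_of% hw, c.w, Category.comp_id] }

/-- Each `D.obj j` is the canonical colimit of the generated objects over it, so a cocone on the
comma category amounts to a cocone on `D`. -/
lemma nonempty_isColimit_commaCocone (hG : IsGeneratedModel M κ G)
    (h : IsCardinalLocallyGenerated E M κ) {c : Cocone D} (hc : IsColimit c) :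
    Nonempty (IsColimit (commaCocone G c)) := by
  have hw (s : Cocone (Comma.fst G D ⋙ G)) {x y : Comma G D} (f : x ⟶ y) :
      G.map f.left ≫ s.ι.app y = s.ι.app x := s.w f
  have H (s : Cocone (Comma.fst G D ⋙ G)) (j : J) := hG.exists_desc h (X := D.obj j) (Z := s.pt)
    (fun t f => s.ι.app { left := t, right := j, hom := f })
    (fun t t' u f => (hw s (x := { left := t, right := j, hom := G.map u ≫ f })
      (y := { left := t', right := j, hom := f }) { left := u, right := 𝟙 j }).symm)
  choose d hd using H
  let σ (s : Cocone (Comma.fst G D ⋙ G)) : Cocone D :=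
    { pt := s.pt
      ι :=
        { app := d s
          naturality i j f := hG.hom_ext h fun t g => by
            dsimp
            rw [Category.comp_id, hd, ← Category.assoc, hd]
            exact ((hw s (x := { left := t, right := i, hom := g })
              (y := { left := t, right := j, hom := g ≫ D.map f })
                { left := 𝟙 t, right := f }).symm.trans (by simp)).symm } }
  exact ⟨{
    desc s := hc.desc (σ s)
    fac s x := by
      change (x.hom ≫ c.ι.app x.right) ≫ hc.desc (σ s) = _
      rw [Category.assoc, hc.fac]
      exact hd s _ _ x.hom
    uniq s m hm := hc.hom_ext fun j => hG.hom_ext h fun t f => by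
      rw [hc.fac]
      exact (Category.assoc _ _ _).symm.trans
        ((hm { left := t, right := j, hom := f }).trans (hd s j t f).symm) }⟩

/-- An upper bound is the colimit of the generated parts, again generated, over an upper bound in
`J`. -/
lemma isCardinalFiltered_comma (hG : IsGeneratedModel M κ G) [HasColimitsOfSize.{w, w} C]
    [IsCardinalFiltered J κ] : IsCardinalFiltered (Comma G D) κ where
  nonempty_cocone K hK := by
    have := hG.full
    have := hG.faithful
    let c := IsCardinalFiltered.cocone (K ⋙ Comma.snd G D) hK
    let Y := K ⋙ Comma.fst G D ⋙ G
    obtain ⟨s, ⟨i⟩⟩ := hG.exists_iso _ (IsCardinalGenerated.of_isColimit hK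
      (fun k => hG.isCardinalGenerated (K.obj k).left) (colimit.isColimit Y))
    let f : colimit Y ⟶ D.obj c.pt := colimit.desc Y
      { pt := D.obj c.pt
        ι :=
          { app k := (K.obj k).hom ≫ D.map (c.ι.app k)
            naturality k l g := by
              have h₁ : G.map (K.map g).left ≫ (K.obj l).hom =
                (K.obj k).hom ≫ D.map (K.map g).right := (K.map g).w
              have h₂ : (K.map g).right ≫ c.ι.app l = c.ι.app k := c.w g
              change G.map (K.map g).left ≫ (K.obj l).hom ≫ D.map (c.ι.app l) =
                ((K.obj k).hom ≫ D.map (c.ι.app k)) ≫ 𝟙 _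
              rw [reassoc_of% h₁, ← D.map_comp, h₂, Category.comp_id] } }
    have hf (k) : colimit.ι Y k ≫ f = (K.obj k).hom ≫ D.map (c.ι.app k) := colimit.ι_desc _ _
    exact ⟨{
      pt := { left := s, right := c.pt, hom := i.hom ≫ f }
      ι :=
        { app k :=
            { left := G.preimage (colimit.ι Y k ≫ i.inv)
              right := c.ι.app k
              w := by simp [hf] }
          naturality k l g := by
            ext
            · apply G.map_injective
              have : G.map (K.map g).left ≫ colimit.ι Y l = colimit.ι Y k := colimit.w Y g
              simp [reassoc_of% this]
            · simpa using c.w g } }⟩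

variable (M G D) in
/-- An object `x : G.obj s ⟶ D.obj j` of the comma category is reduced if all the composites
`G.obj s ⟶ D.obj j ⟶ D.obj k` are in `M`. -/
def isReduced : ObjectProperty (Comma G D) :=
  fun x => ∀ ⦃k : J⦄ (u : x.right ⟶ k), M (x.hom ≫ D.map u)

/-- Fewer than `μ` quotients of `G.obj x.left` ever occur along `D`, so one stage sees them all;
past it, the image can shrink no further. -/
lemma exists_isReduced (hG : IsGeneratedModel M κ G) [HasColimitsOfSize.{w, w} C]
    (h : IsCardinalConvenient E M κ) {μ : Cardinal.{w}} [Fact μ.IsRegular]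
    [IsCardinalFiltered J μ]
    (hμ : ∀ s : S, ∃ Q : ObjectProperty (Under (G.obj s)),
      (fun f : Under (G.obj s) => E f.hom) ≤ Q.isoClosure ∧ HasCardinalLT (Subtype Q) μ)
    (x : Comma G D) : ∃ y : Comma G D, isReduced M G D y ∧ Nonempty (x ⟶ y) := by
  have := hG.full
  have hEM := h.isFactorizationSystem
  obtain ⟨Q, hQ, hQ'⟩ := hμ x.left
  -- The quotients through which `x` factors at some later stage; `m` is a stage beyond a chosen
  -- witness for each.
  let T := { R : Subtype Q // ∃ (k : J) (u : x.right ⟶ k) (b : R.1.right ⟶ D.obj k),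
    R.1.hom ≫ b = x.hom ≫ D.map u }
  choose k u b hb using fun R : T => R.2
  obtain ⟨m, a, v, ha⟩ := IsCardinalFiltered.wideSpan u
    (hQ'.of_injective (Subtype.val : T → _) Subtype.val_injective)
  obtain ⟨B, e, b₀, he, hb₀, fac⟩ := hEM.exists_fac (x.hom ≫ D.map v)
  obtain ⟨t, ⟨i⟩⟩ := hG.exists_iso B ((hG.isCardinalGenerated x.left).of_left h he)
  refine ⟨{ left := t, right := m, hom := i.hom ≫ b₀ }, fun l u' => ?_,
    ⟨{ left := G.preimage (e ≫ i.inv), right := v, w := by simp [fac] }⟩⟩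
  obtain ⟨B', e', m', he', hm', fac'⟩ := hEM.exists_fac (b₀ ≫ D.map u')
  obtain ⟨R, hR, ⟨ψ⟩⟩ := hQ (Under.mk (e ≫ e')) (hEM.left_comp he he')
  have hψ : (e ≫ e') ≫ ψ.hom.right = R.hom := Under.w ψ.hom
  have hψ' : R.hom ≫ ψ.inv.right = e ≫ e' := Under.w ψ.inv
  -- The quotient `e ≫ e'` occurs at stage `l`, so `x` already factors through it at stage `m`.
  -- Hence `e'` is a split monomorphism as well as an epimorphism.
  let R' : T := ⟨⟨R, hR⟩, l, v ≫ u', ψ.inv.right ≫ m', by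
    rw [reassoc_of% hψ', fac', reassoc_of% fac, D.map_comp]⟩
  obtain ⟨d, ⟨hd, -⟩, -⟩ := hEM.orthogonal (hEM.left_comp he he') hb₀ e
    (ψ.hom.right ≫ b R' ≫ D.map (a R')) (by
      have hb' : R.hom ≫ b R' = x.hom ≫ D.map (u R') := hb R'
      rw [← Category.assoc, hψ, reassoc_of% hb', ← D.map_comp, ha, fac])
  have := hEM.epi_of_left h.isCowellpowered e he
  have := hEM.epi_of_left h.isCowellpowered e' he'
  have hd' : e' ≫ d = 𝟙 B := by
    rw [← cancel_epi e]
    simpa using hd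
  have : IsIso e' := ⟨d, hd', by rw [← cancel_epi e', reassoc_of% hd', Category.comp_id]⟩
  dsimp
  rw [Category.assoc, ← fac']
  exact hEM.right_comp (hEM.right_of_isIso _) (hEM.right_comp (hEM.right_of_isIso _) hm')

lemma isCardinalPresentable (hG : IsGeneratedModel M κ G) (h : IsCardinalLocallyGenerated E M κ)
    {μ : Cardinal.{w}} [Fact μ.IsRegular] (hκμ : κ ≤ μ)
    (hμ : ∀ s : S, ∃ Q : ObjectProperty (Under (G.obj s)),
      (fun f : Under (G.obj s) => E f.hom) ≤ Q.isoClosure ∧ HasCardinalLT (Subtype Q) μ)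
    {A : C} (hA : IsCardinalGenerated M κ A) : IsCardinalPresentable A μ where
  preservesColimitOfShape J _ _ := ⟨fun {D} => by
    have := h.hasColimits
    have := hG.full
    have := isFiltered_of_isCardinalFiltered J μ
    have := IsCardinalFiltered.of_le J hκμ
    have := hG.isCardinalFiltered_comma (D := D)
    have := isFiltered_of_isCardinalFiltered (Comma G D) κ
    have hEM := h.isCardinalConvenient.isFactorizationSystem
    let P := isReduced M G D
    have hP (x : Comma G D) : ∃ y : P.FullSubcategory, Nonempty (x ⟶ P.ι.obj y) := by
      obtain ⟨y, hy, hxy⟩ := hG.exists_isReduced h.isCardinalConvenient hμ x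
      exact ⟨⟨y, hy⟩, hxy⟩
    have := isCardinalFiltered_of_fullyFaithful P.ι hP κ
    have := isFiltered_of_isCardinalFiltered P.FullSubcategory κ
    have := Functor.final_of_exists_of_isFiltered_of_fullyFaithful P.ι hP
    let Φ : P.FullSubcategory ⥤ C := P.ι ⋙ Comma.fst G D ⋙ G
    -- Reducedness of `x` puts the composite with `y.obj.hom` in `M`, reducedness of `y` puts
    -- `y.obj.hom` in `M`; cancel.
    have hΦ : IsDiagramOf M Φ := fun x y f => by
      have hw : G.map f.hom.left ≫ y.obj.hom = x.obj.hom ≫ D.map f.hom.right := f.hom.w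
      refine hEM.right_of_comp (g := y.obj.hom) ?_ ?_
      · change M (G.map f.hom.left ≫ y.obj.hom)
        rw [hw]
        exact x.property _
      · simpa using y.property (𝟙 _)
    have := hA.preservesColimit hΦ
    have hcol (c : Cocone D) (hc : IsColimit c) :
        Nonempty (IsColimit ((commaCocone G c).whisker P.ι)) :=
      ⟨(Functor.Final.isColimitWhiskerEquiv P.ι _).symm
        (hG.nonempty_isColimit_commaCocone h hc).some⟩
    refine preservesColimit_coyoneda (fun c hc f => ?_) (fun c hc j p q hpq => ?_)
    · obtain ⟨x, g, hg⟩ := exists_hom_of_preservesColimit_coyoneda (D := Φ) (hcol c hc).some f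
      exact ⟨x.obj.right, g ≫ x.obj.hom, (Category.assoc _ _ _).trans hg⟩
    · obtain ⟨s, ⟨i⟩⟩ := hG.exists_iso A hA
      obtain ⟨y, ⟨α⟩⟩ := hP { left := s, right := j, hom := i.hom ≫ p }
      obtain ⟨z, ⟨β⟩⟩ := hP { left := s, right := j, hom := i.hom ≫ q }
      let y' := IsFiltered.max y z
      let α' := α ≫ P.ι.map (IsFiltered.leftToMax y z)
      let β' := β ≫ P.ι.map (IsFiltered.rightToMax y z)
      have hα : p ≫ D.map α'.right = (i.inv ≫ G.map α'.left) ≫ y'.obj.hom := by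
        have hw : G.map α'.left ≫ y'.obj.hom = (i.hom ≫ p) ≫ D.map α'.right := α'.w
        rw [Category.assoc, hw]
        simp
      have hβ : q ≫ D.map β'.right = (i.inv ≫ G.map β'.left) ≫ y'.obj.hom := by
        have hw : G.map β'.left ≫ y'.obj.hom = (i.hom ≫ q) ≫ D.map β'.right := β'.w
        rw [Category.assoc, hw]
        simp
      obtain ⟨x, γ, hγ⟩ := exists_eq_of_preservesColimit_coyoneda_self (D := Φ) (hcol c hc).some
        (i := y') (i.inv ≫ G.map α'.left) (i.inv ≫ G.map β'.left) (by
          change (i.inv ≫ G.map α'.left) ≫ y'.obj.hom ≫ c.ι.app _ =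
            (i.inv ≫ G.map β'.left) ≫ y'.obj.hom ≫ c.ι.app _
          rw [← Category.assoc, ← hα, ← Category.assoc _ y'.obj.hom, ← hβ]
          rw [Category.assoc, Category.assoc]
          exact (congrArg (p ≫ ·) (c.w α'.right)).trans
            (hpq.trans (congrArg (q ≫ ·) (c.w β'.right)).symm))
      have hw : G.map γ.hom.left ≫ x.obj.hom = y'.obj.hom ≫ D.map γ.hom.right := γ.hom.w
      have hγ' : (i.inv ≫ G.map α'.left) ≫ G.map γ.hom.left =
        (i.inv ≫ G.map β'.left) ≫ G.map γ.hom.left := hγ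
      -- The two routes from `j` to the stage of `x` may differ in `J`, so they are coequalized
      -- last.
      refine ⟨IsFiltered.coeq (α'.right ≫ γ.hom.right) (β'.right ≫ γ.hom.right),
        (α'.right ≫ γ.hom.right) ≫ IsFiltered.coeqHom _ _, ?_⟩
      have e₁ : p ≫ D.map (α'.right ≫ γ.hom.right) = q ≫ D.map (β'.right ≫ γ.hom.right) := by
        rw [D.map_comp, D.map_comp, ← Category.assoc, hα, ← Category.assoc q, hβ,
          Category.assoc, Category.assoc _ _ (D.map _), ← hw, ← Category.assoc, hγ',
          Category.assoc]
      rw [D.map_comp, reassoc_of% e₁, ← D.map_comp, ← D.map_comp, ← IsFiltered.coeq_condition]⟩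

end IsGeneratedModel

lemma IsCardinalLocallyGenerated.isLocallyPresentable (h : IsCardinalLocallyGenerated E M κ) :
    IsLocallyPresentable.{w} C := by
  obtain ⟨S, _, G, hG⟩ := h.exists_isGeneratedModel
  have := h.hasColimits
  choose Q hQ hQ' using fun s : S =>
    (h.isCardinalConvenient.isCowellpowered (G.obj s)).exists_small_le'
  -- The first summand forces `κ ≤ μ`, the second bounds the quotients of every `G.obj s`.
  obtain ⟨μ, hμ, hμ'⟩ := HasCardinalLT.exists_regular_cardinal.{w}
    (κ.ord.ToType ⊕ Σ s : S, Subtype (Q s))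
  have : Fact μ.IsRegular := ⟨hμ⟩
  have hκμ : κ ≤ μ := le_of_lt (by
    simpa [hasCardinalLT_iff_cardinal_mk_lt] using hμ'.of_injective _ Sum.inl_injective)
  have hμ'' (s : S) : ∃ Q : ObjectProperty (Under (G.obj s)),
      (fun f : Under (G.obj s) => E f.hom) ≤ Q.isoClosure ∧ HasCardinalLT (Subtype Q) μ :=
    ⟨Q s, hQ' s, hμ'.of_injective (fun q => Sum.inr ⟨s, q⟩)
      (Sum.inr_injective.comp sigma_mk_injective)⟩
  obtain ⟨𝒜, _, h₁, h₂⟩ := h.exists_generators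
  refine ⟨μ, inferInstance, (IsCardinalLocallyPresentable.iff_exists_isStrongGenerator C μ).2
    ⟨𝒜, inferInstance, .mk_of_exists_colimitsOfShape.{w, w} fun X => ?_,
      fun A hA => hG.isCardinalPresentable h hκμ hμ'' (h₁ A hA)⟩⟩
  obtain ⟨J, _, _, p, hp, -⟩ := h₂ X
  exact ⟨J, inferInstance, ⟨{ p with prop_diag_obj := hp }⟩⟩

/-! ### Local generation from local presentability. -/

/-- Replacing the objects of a `κ`-directed diagram by their images in the colimit yields a
diagram of `M`-morphisms with the same colimit. -/
lemma IsCardinalConvenient.exists_colimitPresentation [HasColimitsOfSize.{w, w} C]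
    (h : IsCardinalConvenient E M κ) {J : Type w} [PartialOrder J] [IsCardinalFiltered J κ]
    {X : C} (p : ColimitPresentation J X) {B : J → C} (e : ∀ j, p.diag.obj j ⟶ B j)
    (m : ∀ j, B j ⟶ X) (he : ∀ j, E (e j)) (hm : ∀ j, M (m j))
    (fac : ∀ j, e j ≫ m j = p.ι.app j) :
    ∃ q : ColimitPresentation J X, q.diag.obj = B ∧ IsDiagramOf M q.diag := by
  have hEM := h.isFactorizationSystem
  choose d hd _ using fun (i j : J) (f : i ⟶ j) =>
    hEM.orthogonal (he i) (hm j) (p.diag.map f ≫ e j) (m i) (by simp [fac, p.w])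
  have hom_ext {i j : J} {f g : B i ⟶ B j} (h₁ : e i ≫ f = e i ≫ g) (h₂ : f ≫ m j = g ≫ m j) :
      f = g := (hEM.orthogonal (he i) (hm j)).hom_ext h₁ h₂
  let Φ : J ⥤ C :=
    { obj := B
      map {i j} f := d i j f
      map_id i := hom_ext (by simp [(hd _ _ _).1]) (by simp [(hd _ _ _).2])
      map_comp {i j k} f g := hom_ext
        (by rw [(hd _ _ _).1, reassoc_of% (hd i j f).1, (hd j k g).1, p.diag.map_comp_assoc])
        (by rw [(hd _ _ _).2, Category.assoc, (hd _ _ _).2, (hd _ _ _).2]) }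
  have hΦ : IsDiagramOf M Φ := fun i j f =>
    hEM.right_of_comp (g := m j) (by
      change M (d i j f ≫ m j)
      rw [(hd i j f).2]
      exact hm i) (hm j)
  let c : Cocone Φ :=
    { pt := X
      ι :=
        { app := m
          naturality i j f := (hd i j f).2.trans (Category.comp_id _).symm } }
  let α : p.diag ⟶ Φ :=
    { app := e
      naturality i j f := (hd i j f).1.symm }
  let g : colimit Φ ⟶ X := colimit.desc Φ c
  have hg (j : J) : colimit.ι Φ j ≫ g = m j := colimit.ι_desc c j
  let t : X ⟶ colimit Φ := p.isColimit.desc ((Cocone.precompose α).obj (colimit.cocone Φ))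
  have ht (j : J) : p.ι.app j ≫ t = e j ≫ colimit.ι Φ j :=
    p.isColimit.fac ((Cocone.precompose α).obj (colimit.cocone Φ)) j
  have htg : t ≫ g = 𝟙 X := p.isColimit.hom_ext fun j => by
    dsimp
    rw [reassoc_of% ht j, hg, fac, Category.comp_id]
  have hgM : M g := h.isClosed.desc_mem J Φ hΦ _ (colimit.isColimit Φ) c hm
  -- The section `t` of `g` is a colimit of the `e j`, so `t` and `t ≫ g = 𝟙 X` are in `E`, whence
  -- `g` is too.
  have hgE : E g := hEM.left_of_comp (by rw [htg]; exact hEM.left_of_isIso _)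
    (hEM.left_of_isColimit α he p.isColimit (colimit.isColimit Φ) t ht)
  have := hEM.isIso_of_left_of_right hgE hgM
  exact ⟨{ diag := Φ
           ι := c.ι
           isColimit := (colimit.isColimit Φ).ofIsoColimit (Cocone.ext (asIso g) hg) }, rfl, hΦ⟩

/-- In a locally `κ`-presentable category, every `κ`-convenient factorization system makes
the category locally `κ`-generated. -/
lemma IsCardinalConvenient.isCardinalLocallyGenerated [IsCardinalLocallyPresentable C κ]
    (h : IsCardinalConvenient E M κ) : IsCardinalLocallyGenerated E M κ := by
  have hEM := h.isFactorizationSystem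
  obtain ⟨P, _, hP⟩ := HasCardinalFilteredGenerator.exists_small_generator C κ
  choose Q hQ hQE hQ' using fun A : C =>
    have := h.isCowellpowered A
    ObjectProperty.EssentiallySmall.exists_small_le (fun f : Under A => E f.hom)
  have (A : C) := hQ A
  refine ⟨inferInstance, h,
    .ofObj (fun x : Σ A : Subtype P, Subtype (Q A.1) => x.2.1.right), inferInstance, ?_, ?_⟩
  · rintro _ ⟨⟨A, hA⟩, ⟨f, hf⟩⟩
    have : IsCardinalPresentable A κ := hP.le_isCardinalPresentable A hA
    exact (isCardinalGenerated_of_isCardinalPresentable M κ A).of_left h (hQE A f hf)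
  · intro X
    obtain ⟨J, _, _, ⟨p⟩⟩ := hP.exists_colimitsOfShape X
    -- Presentability supplies a filtered category; generation asks for a directed poset.
    obtain ⟨α, _, _, F, _⟩ := IsCardinalFiltered.exists_cardinal_directed J κ
    let p' : ColimitPresentation α X := p.toColimitPresentation.reindex F
    have hfac {A : C} (f : A ⟶ X) :
        ∃ (R : Under A) (m : R.right ⟶ X), Q A R ∧ M m ∧ R.hom ≫ m = f := by
      obtain ⟨B, e, m, he, hm, rfl⟩ := hEM.exists_fac f
      obtain ⟨R, hR, ⟨ψ⟩⟩ := hQ' A (Under.mk e) he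
      have hψ : R.hom ≫ ψ.inv.right = e := Under.w ψ.inv
      have : IsIso ψ.inv.right := ((Under.forget A).mapIso ψ).isIso_inv
      exact ⟨R, ψ.inv.right ≫ m, hR, hEM.right_comp (hEM.right_of_isIso _) hm,
        by rw [reassoc_of% hψ]⟩
    choose R m hR hm fac using fun j : α => hfac (p'.ι.app j)
    obtain ⟨q, hq, hq'⟩ := h.exists_colimitPresentation p' (fun j => (R j).hom) m
      (fun j => hQE _ _ (hR j)) hm fac
    refine ⟨α, inferInstance, inferInstance, q, fun j => ?_, hq'⟩
    rw [hq]
    exact ⟨(⟨⟨p'.diag.obj j, p.prop_diag_obj (F.obj j)⟩, ⟨R j, hR j⟩⟩ :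
      Σ A : Subtype P, Subtype (Q A.1))⟩

end

lemma IsConvenient.isLocallyGenerated [IsLocallyPresentable.{w} C] {E M : MorphismProperty C}
    (h : IsConvenient E M) : IsLocallyGenerated E M := by
  obtain ⟨κ, _, h⟩ := h
  obtain ⟨κ', _, _⟩ := IsLocallyPresentable.exists_cardinal.{w} C
  have : Fact (κ ⊔ κ').IsRegular := ⟨iteInduction (fun _ => Fact.out) (fun _ => Fact.out)⟩
  have := IsCardinalLocallyPresentable.of_le C (le_sup_right : κ' ≤ κ ⊔ κ')
  exact ⟨κ ⊔ κ', inferInstance, (h.of_le le_sup_left).isCardinalLocallyGenerated⟩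

/-- In any category, the isomorphisms and all morphisms form a convenient factorization system. -/
lemma isConvenient_isomorphisms_top :
    IsConvenient (MorphismProperty.isomorphisms C) (⊤ : MorphismProperty C) := by
  have := Cardinal.fact_isRegular_aleph0.{w}
  refine ⟨Cardinal.aleph0, inferInstance, ⟨fun {A B} e => ⟨fun he _ _ m _ => ?_,
    fun he => ?_⟩, fun m => ⟨fun _ _ _ e he => ?_, fun _ => trivial⟩, ⟨fun f => ⟨?_⟩⟩⟩,
    fun X => ⟨.singleton (Under.mk (𝟙 X)), inferInstance, fun f hf => ?_⟩,
    fun _ _ _ _ _ _ _ _ => trivial, fun _ _ _ _ _ _ _ _ _ => trivial⟩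
  · have : IsIso e := he
    exact .of_isIso_left e m
  · obtain ⟨d, ⟨hd₁, hd₂⟩, -⟩ := he e trivial (𝟙 A) (𝟙 B) (by simp)
    exact ⟨d, hd₁, hd₂⟩
  · have : IsIso e := he
    exact .of_isIso_left e m
  · exact { Z := _, i := 𝟙 _, p := f, hi := .infer_property _, hp := trivial }
  · have : IsIso f.hom := hf
    exact ⟨Under.mk (𝟙 X), by simp, ⟨Under.isoMk (asIso f.hom).symm (by simp)⟩⟩

end LocGen

theorem mainTheorem3 (C : Type u) [Category.{w} C] :
    List.TFAE [
      IsLocallyPresentable.{w} C,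
      ∃ E M : MorphismProperty C, LocGen.IsConvenient E M ∧ LocGen.IsLocallyGenerated E M,
      ∀ E M : MorphismProperty C, LocGen.IsConvenient E M → LocGen.IsLocallyGenerated E M] := by
  tfae_have 1 → 3 := fun _ _ _ h => h.isLocallyGenerated
  tfae_have 3 → 2 := fun h =>
    ⟨_, _, LocGen.isConvenient_isomorphisms_top, h _ _ LocGen.isConvenient_isomorphisms_top⟩
  tfae_have 2 → 1 := fun ⟨_, _, _, _, _, h⟩ => h.isLocallyPresentable
  tfae_finish
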